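/- Let $\tau$ be a finite relational similarity type (finitely many relation symbols, no constant or function symbols), let $R$ be a further relation symbol of some arity $k$, and let all structures have nonempty universes. For a $\tau$-structure $A$ and a nonempty set $B\subseteq A$ of elements, $A\restriction B$ is the induced substructure, and "substructure" always means a structure of this form. The Gaifman graph $G_A$ has the elements of $A$ as vertices, two distinct elements being adjacent if they occur together in some tuple of some basic relation of $A$; $N_r^A(a)$ is the set of elements at $G_A$-distance at most $r$ from $a$ (elements of other components are at infinite distance), and the pointed $r$-neighbourhood of $a$ is $(A\restriction N_r^A(a),a)$. $A$ has degree at most $d$ if every vertex of $G_A$ has at most $d$ neighbours. The same notions are used for $\tau\cup\{R\}$-structures. Let $\mathfrak K$ be a class of finite $\tau$-structures that is closed under substructures. An $R$-presentation of $A$ is an expansion of $A$ to a $\tau\cup\{R\}$-structure $A^*$ on the same universe. Let $\mathbb P$ be an $R$-presentation scheme for $\mathfrak K$, i.e. a class of $R$-presentations of members of $\mathfrak K$ containing at least one presentation of each member of $\mathfrak K$; write $A^*\,\mathbb P\,A$ if $A^*\in\mathbb P$ is an $R$-presentation of $A$. Suppose that $\mathbb P$ is (a) elementary: there is a first-order sentence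 $\theta_0$ of signature $\tau\cup\{R\}$ such that for every $A\in\mathfrak K$ and every $R$-presentation $A^*$ of $A$, $A^*\in\mathbb P$ if and only if $A^*\models\theta_0$; (b) neighborhood-bounded: there is $\nu\in\mathbb N$ such that $N_1^{A^*}(a)\subseteq N_\nu^{A}(a)$ whenever $A\in\mathfrak K$, $A^*\,\mathbb P\,A$ and $a\in A$; (c) local: (i) if $A\in\mathfrak K$, $A^*\,\mathbb P\,A$ and $B\subseteq A$ is finite and nonempty, then $(A^*\restriction B)\,\mathbb P\,(A\restriction B)$; (ii) if $A\in\mathfrak K$, $B,C\subseteq A$ are finite, nonempty and disjoint, $B^*\,\mathbb P\,(A\restriction B)$ and $C^*\,\mathbb P\,(A\restriction C)$, then there is $A^*\,\mathbb P\,A$ with $A^*\restriction B=B^*$ and $A^*\restriction C=C^*$. Let $\mathfrak J$ be a class of $\tau$-structures that is a $\mathbb P$-invariant elementary boolean query on $\mathfrak K$: there is a first-order sentence $\theta$ of signature $\tau\cup\{R\}$ such that for every $A\in\mathfrak K$, $\theta$ holds in some $A^*$ with $A^*\,\mathbb P\,A$ if and only if it holds in every such $A^*$, and $A\in\mathfrak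 J$ if and only if $\theta$ holds in some $A^*$ with $A^*\,\mathbb P\,A$. Then for every $d\in\mathbb N$ there are $r,t\in\mathbb N$ such that $\mathfrak J$ is Hanf $(r,t)$-threshold local on the members of $\mathfrak K$ of degree at most $d$: whenever $A,B\in\mathfrak K$ have degree at most $d$ and, for every pointed $\tau$-structure $C$, the number of $a\in A$ whose pointed $r$-neighbourhood is isomorphic to $C$ and the number of $b\in B$ whose pointed $r$-neighbourhood is isomorphic to $C$ are equal or both at least $t$, then $A\in\mathfrak J$ if and only if $B\in\mathfrak J$. -/

import Mathlib

universe u v w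

namespace HanfLocality

open FirstOrder

section Structures

variable {L : FirstOrder.Language.{v, w}}

/-- A class of `L`-structures: a property of a universe together with an `L`-structure on it. -/
abbrev StructClass (L : FirstOrder.Language.{v, w}) : Type (max (u + 1) v w) :=
  ∀ α : Type u, L.Structure α → Prop

/-- For a relational language, the structure induced by `S` on an arbitrary set `B` of elements. -/
@[reducible]
def restrict [L.IsRelational] {α : Type u} (S : L.Structure α) (B : Set α) : L.Structure B where
  funMap f _ := isEmptyElim f
  RelMap R x := S.RelMap R (fun i => (x i : α))

/-- The Gaifman graph: distinct elements are adjacent when they occur together in some tuple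
of some basic relation. -/
def gaifman {α : Type u} (S : L.Structure α) : SimpleGraph α where
  Adj a b := a ≠ b ∧ ∃ (n : ℕ) (R : L.Relations n) (c : Fin n → α),
    S.RelMap R c ∧ (∃ i, c i = a) ∧ (∃ j, c j = b)
  symm := ⟨fun _ _ ⟨hne, n, R, c, hc, ha, hb⟩ => ⟨hne.symm, n, R, c, hc, hb, ha⟩⟩
  loopless := ⟨fun _ h => h.1 rfl⟩

/-- The closed ball of radius `r` in the Gaifman graph; elements in other connected components
are at distance `⊤`. -/
def nbhd {α : Type u} (S : L.Structure α) (a : α) (r : ℕ) : Set α :=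
  {b | (gaifman S).edist a b ≤ r}

theorem self_mem_nbhd {α : Type u} (S : L.Structure α) (a : α) (r : ℕ) : a ∈ nbhd S a r := by
  simp [nbhd]

/-- Every element has at most `d` neighbours in the Gaifman graph. -/
def DegreeBounded {α : Type u} (S : L.Structure α) (d : ℕ) : Prop :=
  ∀ a : α, ((gaifman S).neighborSet a).encard ≤ d

/-- The pointed `r`-neighbourhood of `a` is isomorphic to the pointed structure `(γ, T, c)`. -/
def NbhdIso [L.IsRelational] {α : Type u} (S : L.Structure α) (a : α) (r : ℕ)
    {γ : Type u} (T : L.Structure γ) (c : γ) : Prop :=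
  letI := restrict S (nbhd S a r)
  letI := T
  ∃ f : nbhd S a r ≃[L] γ, f ⟨a, self_mem_nbhd S a r⟩ = c

/-- Two sets are equipollent up to threshold `t`: they have the same number of elements, or both
have at least `t` elements. -/
def EquipollentUpTo (t : ℕ) {α β : Type u} (X : Set α) (Y : Set β) : Prop :=
  X.encard = Y.encard ∨ ((t : ℕ∞) ≤ X.encard ∧ (t : ℕ∞) ≤ Y.encard)

/-- Hanf threshold `(r, t)`-equivalence: each isomorphism type of pointed `r`-neighbourhoods is
realized the same number of times, up to threshold `t`. -/
def HanfEquiv [L.IsRelational] (r t : ℕ) {α β : Type u} (S : L.Structure α)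
    (S' : L.Structure β) : Prop :=
  ∀ (γ : Type u) (T : L.Structure γ) (c : γ),
    EquipollentUpTo t {a : α | NbhdIso S a r T c} {b : β | NbhdIso S' b r T c}

/-- `J` is Hanf `(r, t)`-threshold local on `K`: members of `K` that are `(r, t)`-equivalent
agree on `J`. -/
def HanfThresholdLocal [L.IsRelational] (r t : ℕ) (J K : StructClass.{u} L) : Prop :=
  ∀ (α β : Type u) (S : L.Structure α) (S' : L.Structure β),
    K α S → K β S' → HanfEquiv r t S S' → (J α S ↔ J β S')

/-- Closure under (nonempty, induced) substructures. -/
def SubstructureClosed [L.IsRelational] (K : StructClass.{u} L) : Prop :=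
  ∀ (α : Type u) (S : L.Structure α), K α S →
    ∀ B : Set α, B.Nonempty → K B (restrict S B)

end Structures

section Presentations

/-- The language whose only symbol is one relation symbol, of arity `k`. -/
def singleRel (k : ℕ) : FirstOrder.Language.{0, 0} where
  Functions _ := Empty
  Relations n := PLift (n = k)

instance (k : ℕ) : (singleRel k).IsRelational := fun _ => inferInstanceAs (IsEmpty Empty)

/-- The language `L ∪ {R}` with a new relation symbol `R` of arity `k`. -/
abbrev withRel (L : FirstOrder.Language.{v, w}) (k : ℕ) : FirstOrder.Language.{v, w} :=
  L.sum (singleRel k)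

variable {L : FirstOrder.Language.{v, w}} {k : ℕ}

/-- The `L`-reduct of an `L ∪ {R}`-structure. -/
@[reducible]
def reduct {α : Type u} (S' : (withRel L k).Structure α) : L.Structure α :=
  letI := S'
  (FirstOrder.Language.LHom.sumInl : L →ᴸ withRel L k).reduct α

/-- An `R`-presentation of `(α, S)` is an expansion `S'` of `S` to `L ∪ {R}` on the same universe.
`Presents P S' S` says that `S'` is an `R`-presentation of `S` which belongs to the class `P`. -/
def Presents (P : StructClass.{u} (withRel L k)) {α : Type u}
    (S' : (withRel L k).Structure α) (S : L.Structure α) : Prop :=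
  P α S' ∧ reduct S' = S

/-- Satisfaction of a sentence in an explicitly given structure. -/
def Sat {M : FirstOrder.Language.{v, w}} {α : Type u} (S : M.Structure α) (φ : M.Sentence) : Prop :=
  letI := S
  α ⊨ φ

/-- `P` is a class of `R`-presentations of members of `K` that contains at least one presentation
of each member of `K`. -/
def IsPresentationScheme (P : StructClass.{u} (withRel L k)) (K : StructClass.{u} L) : Prop :=
  (∀ (α : Type u) (S' : (withRel L k).Structure α), P α S' → K α (reduct S')) ∧
  (∀ (α : Type u) (S : L.Structure α), K α S →
    ∃ S' : (withRel L k).Structure α, Presents P S' S)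

/-- Among the `R`-presentations of members of `K`, those in `P` are defined by one first-order
sentence. -/
def IsElementaryScheme (P : StructClass.{u} (withRel L k)) (K : StructClass.{u} L) : Prop :=
  ∃ θ : (withRel L k).Sentence, ∀ (α : Type u) (S : L.Structure α), K α S →
    ∀ S' : (withRel L k).Structure α, reduct S' = S → (P α S' ↔ Sat S' θ)

/-- For some constant `ν`, Gaifman neighbours in a presentation of a member of `K` are at distance
at most `ν` in the Gaifman graph of that member. -/
def IsNeighborhoodBounded (P : StructClass.{u} (withRel L k)) (K : StructClass.{u} L) : Prop :=
  ∃ ν : ℕ, ∀ (α : Type u) (S : L.Structure α), K α S →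
    ∀ S' : (withRel L k).Structure α, Presents P S' S →
      ∀ a : α, nbhd S' a 1 ⊆ nbhd S a ν

/-- Localization: restricting a presentation of a structure to a finite substructure gives a
presentation of that substructure. -/
def HasLocalization [L.IsRelational] (P : StructClass.{u} (withRel L k))
    (K : StructClass.{u} L) : Prop :=
  ∀ (α : Type u) (S : L.Structure α), K α S →
    ∀ S' : (withRel L k).Structure α, Presents P S' S →
      ∀ B : Set α, B.Nonempty → B.Finite → Presents P (restrict S' B) (restrict S B)

/-- Disjoint local amalgamation: presentations of two disjoint finite substructures extend
simultaneously to a presentation of the whole structure. -/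
def HasDisjointLocalAmalgamation [L.IsRelational] (P : StructClass.{u} (withRel L k))
    (K : StructClass.{u} L) : Prop :=
  ∀ (α : Type u) (S : L.Structure α), K α S →
    ∀ B C : Set α, B.Nonempty → C.Nonempty → B.Finite → C.Finite → Disjoint B C →
      ∀ (SB : (withRel L k).Structure B) (SC : (withRel L k).Structure C),
        Presents P SB (restrict S B) → Presents P SC (restrict S C) →
          ∃ S' : (withRel L k).Structure α,
            Presents P S' S ∧ restrict S' B = SB ∧ restrict S' C = SC

/-- Local presentation schemes. -/
def IsLocalScheme [L.IsRelational] (P : StructClass.{u} (withRel L k))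
    (K : StructClass.{u} L) : Prop :=
  HasLocalization P K ∧ HasDisjointLocalAmalgamation P K

/-- `θ` is `P`-invariant over `K`: it holds in some `P`-presentation of a member of `K` exactly
when it holds in all of them. -/
def IsInvariantSentence (P : StructClass.{u} (withRel L k)) (K : StructClass.{u} L)
    (θ : (withRel L k).Sentence) : Prop :=
  ∀ (α : Type u) (S : L.Structure α), K α S →
    ((∃ S' : (withRel L k).Structure α, Presents P S' S ∧ Sat S' θ) ↔
      (∀ S' : (withRel L k).Structure α, Presents P S' S → Sat S' θ))

/-- `J` is a `P`-invariant elementary boolean query on `K`. -/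
def IsInvariantElementary (P : StructClass.{u} (withRel L k)) (K J : StructClass.{u} L) : Prop :=
  ∃ θ : (withRel L k).Sentence, IsInvariantSentence P K θ ∧
    ∀ (α : Type u) (S : L.Structure α), K α S →
      (J α S ↔ ∃ S' : (withRel L k).Structure α, Presents P S' S ∧ Sat S' θ)

end Presentations

end HanfLocality

namespace HanfLocality

open FirstOrder

/-! ### Partial isomorphisms, balls and neighbourhood types. -/

section PartialIso

variable {L : FirstOrder.Language.{v, w}} {α β γ : Type u}

/-! It suffices to find, for Hanf-equivalent `S` and `S'` of bounded degree, presentations `A` and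
`B` that are themselves Hanf-equivalent in the larger language. By neighbourhood-boundedness they
have bounded degree, so the classical Hanf theorem (`exists_sat_iff_of_hanfEquiv`) makes them agree
on the invariant sentence, and invariance passes the agreement to `S` and `S'`.

The pair comes from a maximality argument (`exists_presents_hanfEquiv`). To every presentation of
`S` or of `S'` attach the vector counting, up to `t`, the realizations of each type of
`r`-neighbourhood. The degree bound leaves finitely many types, hence finitely many vectors; choose
a maximal one, attained say by a presentation `A` of `S`. Pick up to `t` realizations of each type
in `A`. Their `r`-neighbourhoods in `A` lie in the `ν * r`-balls of `S` around them, and these balls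
have an isomorphic copy in `S'` (`exists_isBallIso_of_hanfEquiv`). Locality carries the part of `A`
living there over to `S'` and extends it to a presentation `B` (`exists_presents_isPartialIso`). The
copied neighbourhoods keep their types, so the vector of `B` dominates that of `A`, and maximality
forces equality.

Both the Hanf theorem and the copying of balls rest on one back-and-forth step, `IsBallIso.extend`.
-/

theorem mem_nbhd {S : L.Structure α} {a b : α} {r : ℕ} :
    b ∈ nbhd S a r ↔ (gaifman S).edist a b ≤ r := Iff.rfl

theorem nbhd_symm {S : L.Structure α} {a b : α} {r : ℕ} (h : b ∈ nbhd S a r) :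
    a ∈ nbhd S b r := by
  rw [mem_nbhd, SimpleGraph.edist_comm]
  exact h

theorem nbhd_trans {S : L.Structure α} {a b c : α} {r s : ℕ} (h : b ∈ nbhd S a r)
    (h' : c ∈ nbhd S b s) : c ∈ nbhd S a (r + s) := by
  have := SimpleGraph.edist_triangle (G := gaifman S) (u := a) (v := b) (w := c)
  refine this.trans ?_
  push_cast
  exact add_le_add h h'

theorem nbhd_mono (S : L.Structure α) (a : α) {r s : ℕ} (h : r ≤ s) :
    nbhd S a r ⊆ nbhd S a s := fun _ hb =>
  mem_nbhd.2 ((mem_nbhd.1 hb).trans (by exact_mod_cast h))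

theorem nbhd_zero (S : L.Structure α) (a : α) : nbhd S a 0 = {a} := by
  ext b
  rw [mem_nbhd, Nat.cast_zero, nonpos_iff_eq_zero, SimpleGraph.edist_eq_zero_iff,
    Set.mem_singleton_iff, eq_comm]

theorem mem_nbhd_one {S : L.Structure α} {a b : α} :
    b ∈ nbhd S a 1 ↔ b = a ∨ (gaifman S).Adj a b := by
  constructor
  · intro h
    by_cases hab : b = a
    · exact Or.inl hab
    · right
      have h1 : (gaifman S).edist a b ≤ 1 := by simpa [nbhd] using h
      have h2 : (gaifman S).edist a b ≠ 0 := fun h0 => hab (SimpleGraph.edist_eq_zero_iff.1 h0).symm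
      exact SimpleGraph.edist_eq_one_iff_adj.1 (le_antisymm h1 (Order.one_le_iff_ne_zero.2 h2))
  · rintro (rfl | h)
    · exact self_mem_nbhd S b 1
    · have := SimpleGraph.edist_eq_one_iff_adj.2 h
      simp [nbhd, this]

theorem mem_nbhd_succ {S : L.Structure α} {a b : α} {r : ℕ} :
    b ∈ nbhd S a (r + 1) ↔ ∃ c ∈ nbhd S a r, b ∈ nbhd S c 1 := by
  constructor
  · intro h
    have hne : (gaifman S).edist b a ≠ ⊤ := by
      have h' := nbhd_symm h
      exact ne_top_of_le_ne_top (ENat.natCast_ne_top (r + 1)) h'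
    obtain ⟨p, hp⟩ := SimpleGraph.exists_walk_of_edist_ne_top hne
    have hlen : p.length ≤ r + 1 := by
      have h' : (gaifman S).edist b a ≤ ((r + 1 : ℕ) : ℕ∞) := nbhd_symm h
      rw [← hp] at h'
      exact_mod_cast h'
    cases p with
    | nil => exact ⟨_, self_mem_nbhd S _ r, self_mem_nbhd S _ 1⟩
    | @cons _ c _ hbc q =>
      refine ⟨c, nbhd_symm ?_, mem_nbhd_one.2 (Or.inr hbc.symm)⟩
      have : (gaifman S).edist c a ≤ q.length := SimpleGraph.edist_le q
      refine this.trans ?_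
      rw [SimpleGraph.Walk.length_cons] at hlen
      exact_mod_cast Nat.le_of_succ_le_succ hlen
  · rintro ⟨c, hc, hb⟩
    exact nbhd_trans hc hb

theorem mem_nbhd_one_of_relMap {S : L.Structure α} {n : ℕ} {R : L.Relations n} {x : Fin n → α}
    (h : S.RelMap R x) (i j : Fin n) : x j ∈ nbhd S (x i) 1 := by
  rw [mem_nbhd_one]
  by_cases hij : x j = x i
  · exact Or.inl hij
  · exact Or.inr ⟨fun h' => hij h'.symm, n, R, x, h, ⟨i, rfl⟩, ⟨j, rfl⟩⟩

/-- The `r`-ball around a set. -/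
def ball (S : L.Structure α) (X : Set α) (r : ℕ) : Set α := {b | ∃ a ∈ X, b ∈ nbhd S a r}

theorem ball_mono (S : L.Structure α) {X Y : Set α} {r s : ℕ} (hXY : X ⊆ Y) (h : r ≤ s) :
    ball S X r ⊆ ball S Y s := fun _ ⟨a, ha, hb⟩ => ⟨a, hXY ha, nbhd_mono S a h hb⟩

theorem subset_ball (S : L.Structure α) (X : Set α) (r : ℕ) : X ⊆ ball S X r :=
  fun a ha => ⟨a, ha, self_mem_nbhd S a r⟩

/-- The map `f` restricts to an isomorphism from the substructure on `X` to that on `Y`. -/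
structure IsPartialIso (S : L.Structure α) (S' : L.Structure β) (X : Set α) (Y : Set β)
    (f : α → β) : Prop where
  bijOn : Set.BijOn f X Y
  rel : ∀ (n : ℕ) (R : L.Relations n) (x : Fin n → α), (∀ i, x i ∈ X) →
    (S.RelMap R x ↔ S'.RelMap R (f ∘ x))

variable {S : L.Structure α} {S' : L.Structure β} {S'' : L.Structure γ} {X : Set α} {Y : Set β}
  {Z : Set γ} {f : α → β} {g : β → γ}

theorem IsPartialIso.refl (S : L.Structure α) (X : Set α) : IsPartialIso S S X X id :=
  ⟨Set.bijOn_id X, fun _ _ _ _ => Iff.rfl⟩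

theorem IsPartialIso.trans (hg : IsPartialIso S' S'' Y Z g) (hf : IsPartialIso S S' X Y f) :
    IsPartialIso S S'' X Z (g ∘ f) :=
  ⟨hg.bijOn.comp hf.bijOn, fun n R x hx => (hf.rel n R x hx).trans
    (hg.rel n R (f ∘ x) fun i => hf.bijOn.mapsTo (hx i))⟩

theorem IsPartialIso.exists_symm [Nonempty α] (hf : IsPartialIso S S' X Y f) :
    ∃ g : β → α, IsPartialIso S' S Y X g ∧ Set.LeftInvOn g f X ∧ Set.RightInvOn g f Y := by
  have hinv := hf.bijOn.invOn_invFunOn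
  have hm := hf.bijOn.surjOn.mapsTo_invFunOn
  refine ⟨Function.invFunOn f X, ⟨hinv.symm.bijOn hm hf.bijOn.mapsTo, ?_⟩, hinv.1, hinv.2⟩
  intro n R x hx
  rw [hf.rel n R (Function.invFunOn f X ∘ x) fun i => hm (hx i)]
  have : f ∘ Function.invFunOn f X ∘ x = x := funext fun i => hinv.2 (hx i)
  rw [this]

theorem IsPartialIso.congr (hf : IsPartialIso S S' X Y f) {f' : α → β} (h : Set.EqOn f f' X) :
    IsPartialIso S S' X Y f' := by
  refine ⟨hf.bijOn.congr h, fun n R x hx => ?_⟩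
  have : f ∘ x = f' ∘ x := funext fun i => h (hx i)
  rw [hf.rel n R x hx, this]

/-- A tuple witnessing an edge that leaves the `r`-ball lies wholly in the `(r + 1)`-ball, hence in
`X`, where `f` preserves relations; so paths from `a` are carried to paths. -/
theorem IsPartialIso.mapsTo_nbhd (hf : IsPartialIso S S' X Y f) {a : α} {r : ℕ}
    (ha : nbhd S a r ⊆ X) : Set.MapsTo f (nbhd S a r) (nbhd S' (f a) r) := by
  induction r with
  | zero =>
    rw [nbhd_zero, nbhd_zero]
    rintro _ rfl
    rfl
  | succ r ih =>
    intro b hb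
    obtain ⟨c, hc, hbc⟩ := mem_nbhd_succ.1 hb
    refine mem_nbhd_succ.2 ⟨f c, ih ((nbhd_mono S a (Nat.le_succ r)).trans ha) hc, ?_⟩
    rcases mem_nbhd_one.1 hbc with rfl | ⟨_, n, R, x, hx, ⟨i, rfl⟩, ⟨j, rfl⟩⟩
    · exact self_mem_nbhd _ _ _
    · have hX : ∀ l, x l ∈ X := fun l =>
        ha (mem_nbhd_succ.2 ⟨x i, hc, mem_nbhd_one_of_relMap hx i l⟩)
      exact mem_nbhd_one_of_relMap ((hf.rel n R x hX).1 hx) i j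

theorem IsPartialIso.image_nbhd (hf : IsPartialIso S S' X Y f) {a : α} {r : ℕ}
    (ha : nbhd S a r ⊆ X) (ha' : nbhd S' (f a) r ⊆ Y) :
    f '' nbhd S a r = nbhd S' (f a) r := by
  have : Nonempty α := ⟨a⟩
  refine (hf.mapsTo_nbhd ha).image_subset.antisymm fun b hb => ?_
  obtain ⟨g, hg, hl, hr⟩ := hf.exists_symm
  have h := hg.mapsTo_nbhd ha' hb
  rw [hl (ha (self_mem_nbhd S a r))] at h
  exact ⟨g b, h, hr (ha' hb)⟩

theorem IsPartialIso.mono (hf : IsPartialIso S S' X Y f) {X' : Set α} (h : X' ⊆ X) :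
    IsPartialIso S S' X' (f '' X') f :=
  ⟨(hf.bijOn.injOn.mono h).bijOn_image, fun n R x hx => hf.rel n R x fun i => h (hx i)⟩

theorem IsPartialIso.nbhd (hf : IsPartialIso S S' X Y f) {a : α} {r : ℕ}
    (ha : nbhd S a r ⊆ X) (ha' : nbhd S' (f a) r ⊆ Y) :
    IsPartialIso S S' (nbhd S a r) (nbhd S' (f a) r) f := by
  rw [← hf.image_nbhd ha ha']
  exact hf.mono ha

theorem IsPartialIso.ball (hf : IsPartialIso S S' X Y f) {A : Set α} {r : ℕ}
    (h : ball S A r ⊆ X) (h' : ball S' (f '' A) r ⊆ Y) :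
    IsPartialIso S S' (ball S A r) (ball S' (f '' A) r) f := by
  have key : ∀ a ∈ A, f '' HanfLocality.nbhd S a r = HanfLocality.nbhd S' (f a) r := fun a ha =>
    hf.image_nbhd (fun b hb => h ⟨a, ha, hb⟩) (fun b hb => h' ⟨f a, ⟨a, ha, rfl⟩, hb⟩)
  have : f '' HanfLocality.ball S A r = HanfLocality.ball S' (f '' A) r := by
    ext b
    constructor
    · rintro ⟨x, ⟨a, ha, hx⟩, rfl⟩
      exact ⟨f a, ⟨a, ha, rfl⟩, key a ha ▸ ⟨x, hx, rfl⟩⟩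
    · rintro ⟨_, ⟨a, ha, rfl⟩, hb⟩
      rw [← key a ha] at hb
      obtain ⟨x, hx, rfl⟩ := hb
      exact ⟨x, ⟨a, ha, hx⟩, rfl⟩
  rw [← this]
  exact hf.mono h

/-- Isomorphism of pointed `r`-neighbourhoods. -/
def SameType (r : ℕ) (S : L.Structure α) (a : α) (S' : L.Structure β) (b : β) : Prop :=
  ∃ f : α → β, IsPartialIso S S' (nbhd S a r) (nbhd S' b r) f ∧ f a = b

theorem SameType.refl (r : ℕ) (S : L.Structure α) (a : α) : SameType r S a S a :=
  ⟨id, IsPartialIso.refl S _, rfl⟩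

theorem SameType.trans {r : ℕ} {a : α} {b : β} {c : γ} (h : SameType r S a S' b)
    (h' : SameType r S' b S'' c) : SameType r S a S'' c := by
  obtain ⟨f, hf, rfl⟩ := h
  obtain ⟨g, hg, rfl⟩ := h'
  exact ⟨g ∘ f, hg.trans hf, rfl⟩

theorem SameType.symm {r : ℕ} {a : α} {b : β} (h : SameType r S a S' b) :
    SameType r S' b S a := by
  obtain ⟨f, hf, rfl⟩ := h
  have : Nonempty α := ⟨a⟩
  obtain ⟨g, hg, hl, -⟩ := hf.exists_symm
  exact ⟨g, hg, hl (self_mem_nbhd S a r)⟩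

theorem SameType.mono {r s : ℕ} {a : α} {b : β} (h : SameType s S a S' b) (hrs : r ≤ s) :
    SameType r S a S' b := by
  obtain ⟨f, hf, rfl⟩ := h
  exact ⟨f, hf.nbhd (nbhd_mono S a hrs) (nbhd_mono S' _ hrs), rfl⟩

variable [L.IsRelational]

/-- Replaces isomorphisms of subtypes by total maps with a domain of validity, which compose and
restrict without coercions. -/
theorem nbhdIso_iff {a : α} {r : ℕ} {T : L.Structure γ} {c : γ} :
    NbhdIso S a r T c ↔
      ∃ f : α → γ, IsPartialIso S T (nbhd S a r) Set.univ f ∧ f a = c := by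
  classical
  constructor
  · let _ := restrict S (nbhd S a r)
    rintro ⟨e, he⟩
    let f : α → γ := fun x => if h : x ∈ nbhd S a r then e.toEquiv ⟨x, h⟩ else c
    have hfe : ∀ x (h : x ∈ nbhd S a r), f x = e.toEquiv ⟨x, h⟩ := fun x h => dif_pos h
    refine ⟨f, ⟨⟨fun _ _ => Set.mem_univ _, ?_, ?_⟩, ?_⟩, ?_⟩
    · intro x hx y hy hxy
      rw [hfe x hx, hfe y hy] at hxy
      exact congrArg Subtype.val (e.toEquiv.injective hxy)
    · intro y _
      refine ⟨e.toEquiv.symm y, (e.toEquiv.symm y).2, ?_⟩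
      rw [hfe _ (e.toEquiv.symm y).2]
      exact e.toEquiv.apply_symm_apply y
    · intro n R x hx
      have h1 := e.map_rel' R fun i => ⟨x i, hx i⟩
      have h2 : f ∘ x = e.toEquiv ∘ fun i => (⟨x i, hx i⟩ : nbhd S a r) :=
        funext fun i => hfe _ (hx i)
      rw [h2]
      exact h1.symm
    · rw [hfe a (self_mem_nbhd S a r)]
      exact he
  · rintro ⟨f, hf, hfa⟩
    let _ := restrict S (nbhd S a r)
    let _ := T
    refine ⟨⟨(Set.BijOn.equiv f hf.bijOn).trans (Equiv.Set.univ γ), ?_, ?_⟩, hfa⟩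
    · intro n F
      exact isEmptyElim F
    · intro n R x
      exact (hf.rel n R (fun i => (x i : α)) fun i => (x i).2).symm

theorem isPartialIso_restrict (S : L.Structure α) (X : Set α) :
    IsPartialIso (restrict S X) S Set.univ X Subtype.val :=
  ⟨⟨fun x _ => x.2, Subtype.val_injective.injOn, fun x hx => ⟨⟨x, hx⟩, trivial, rfl⟩⟩,
    fun _ _ _ _ => Iff.rfl⟩

theorem nbhdIso_restrict_iff {a : α} {b : β} {r : ℕ} :
    NbhdIso S' b r (restrict S (nbhd S a r)) ⟨a, self_mem_nbhd S a r⟩ ↔ SameType r S a S' b := by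
  have h0 := isPartialIso_restrict S (nbhd S a r)
  rw [nbhdIso_iff]
  constructor
  · rintro ⟨f, hf, hfb⟩
    refine SameType.symm ⟨Subtype.val ∘ f, h0.trans hf, ?_⟩
    simp [hfb]
  · intro h
    obtain ⟨f, hf, hfb⟩ := h.symm
    have : Nonempty (nbhd S a r) := ⟨⟨a, self_mem_nbhd S a r⟩⟩
    obtain ⟨g, hg, hl, -⟩ := h0.exists_symm
    refine ⟨g ∘ f, hg.trans hf, ?_⟩
    have := hl (Set.mem_univ (⟨a, self_mem_nbhd S a r⟩ : nbhd S a r))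
    simpa [hfb] using this

theorem NbhdIso.congr {a : α} {b : β} {r : ℕ} {T : L.Structure γ} {c : γ}
    (h : NbhdIso S a r T c) (hab : SameType r S a S' b) : NbhdIso S' b r T c := by
  obtain ⟨f, hf, hfa⟩ := nbhdIso_iff.1 h
  obtain ⟨g, hg, hgb⟩ := hab.symm
  exact nbhdIso_iff.2 ⟨f ∘ g, hf.trans hg, by simp [hgb, hfa]⟩

theorem NbhdIso.sameType {a : α} {b : β} {r : ℕ} {T : L.Structure γ} {c : γ}
    (h : NbhdIso S a r T c) (h' : NbhdIso S' b r T c) : SameType r S a S' b := by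
  obtain ⟨f, hf, hfa⟩ := nbhdIso_iff.1 h
  obtain ⟨g, hg, hgb⟩ := nbhdIso_iff.1 h'
  have : Nonempty β := ⟨b⟩
  obtain ⟨k, hk, hl, -⟩ := hg.exists_symm
  refine ⟨k ∘ f, hk.trans hf, ?_⟩
  have := hl (self_mem_nbhd S' b r)
  simpa [hfa, ← hgb] using this

end PartialIso

/-! ### Ball sizes and counting up to a threshold. -/

section Counting

variable {L : FirstOrder.Language.{v, w}} {α β : Type u}

theorem encard_biUnion_le_mul {ι : Type*} {X : Set ι} {n m : ℕ} (hX : X.encard ≤ n)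
    {s : ι → Set α} (hs : ∀ a ∈ X, (s a).encard ≤ m) :
    (⋃ a ∈ X, s a).encard ≤ (n * m : ℕ) := by
  have hfin : X.Finite := Set.finite_of_encard_le_coe hX
  lift X to Finset ι using hfin
  refine (X.set_encard_biUnion_le s).trans ((Finset.sum_le_sum hs).trans ?_)
  rw [Set.encard_coe_eq_coe_finsetCard] at hX
  rw [Finset.sum_const, nsmul_eq_mul]
  have : X.card ≤ n := by exact_mod_cast hX
  exact_mod_cast Nat.mul_le_mul_right m this

theorem DegreeBounded.encard_nbhd_le {S : L.Structure α} {d : ℕ} (h : DegreeBounded S d) (a : α)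
    (r : ℕ) : (nbhd S a r).encard ≤ ((d + 1) ^ r : ℕ) := by
  have h1 : ∀ b, (nbhd S b 1).encard ≤ (d + 1 : ℕ) := fun b => by
    have : nbhd S b 1 = insert b ((gaifman S).neighborSet b) := Set.ext fun c => mem_nbhd_one
    rw [this]
    refine (Set.encard_insert_le _ _).trans ?_
    push_cast
    gcongr
    exact h b
  induction r with
  | zero => simp [nbhd_zero]
  | succ r ih =>
    have : nbhd S a (r + 1) = ⋃ b ∈ nbhd S a r, nbhd S b 1 := by
      ext c
      simp only [Set.mem_iUnion, exists_prop]
      exact mem_nbhd_succ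
    rw [this, pow_succ]
    exact encard_biUnion_le_mul ih fun b _ => h1 b

theorem DegreeBounded.encard_ball_le {S : L.Structure α} {d : ℕ} (h : DegreeBounded S d)
    {X : Set α} {n : ℕ} (hX : X.encard ≤ n) (r : ℕ) :
    (ball S X r).encard ≤ (n * (d + 1) ^ r : ℕ) := by
  have : ball S X r = ⋃ a ∈ X, nbhd S a r := by
    ext c
    simp only [Set.mem_iUnion, exists_prop]
    rfl
  rw [this]
  exact encard_biUnion_le_mul hX fun a _ => h.encard_nbhd_le a r

theorem EquipollentUpTo.symm {t : ℕ} {X : Set α} {Y : Set β} (h : EquipollentUpTo t X Y) :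
    EquipollentUpTo t Y X := h.imp Eq.symm And.symm

theorem EquipollentUpTo.mono {t t' : ℕ} {X : Set α} {Y : Set β} (h : EquipollentUpTo t X Y)
    (ht : t' ≤ t) : EquipollentUpTo t' X Y :=
  have ht' : (t' : ℕ∞) ≤ t := by exact_mod_cast ht
  h.imp_right fun h => ⟨ht'.trans h.1, ht'.trans h.2⟩

/-- If some fibre over `M` is large on both sides, so are both preimages. Otherwise all fibres over
`M` are finite of equal size, and fibrewise bijections glue. -/
theorem EquipollentUpTo.preimage {t : ℕ} {Θ : Type*} {p : α → Θ} {q : β → Θ}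
    (h : ∀ θ, EquipollentUpTo t (p ⁻¹' {θ}) (q ⁻¹' {θ})) (M : Set Θ) :
    EquipollentUpTo t (p ⁻¹' M) (q ⁻¹' M) := by
  by_cases hM : ∃ θ ∈ M, (t : ℕ∞) ≤ (p ⁻¹' {θ}).encard ∧ (t : ℕ∞) ≤ (q ⁻¹' {θ}).encard
  · obtain ⟨θ, hθ, h1, h2⟩ := hM
    have hsub : ({θ} : Set Θ) ⊆ M := Set.singleton_subset_iff.2 hθ
    exact Or.inr ⟨h1.trans (Set.encard_le_encard (Set.preimage_mono hsub)),
      h2.trans (Set.encard_le_encard (Set.preimage_mono hsub))⟩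
  · push Not at hM
    have hfib : ∀ θ : M, Nonempty (p ⁻¹' {θ.1} ≃ q ⁻¹' {θ.1}) := fun θ => by
      have heq : (p ⁻¹' {θ.1}).encard = (q ⁻¹' {θ.1}).encard := (h θ.1).elim id fun h' =>
        absurd h'.2 (not_le.2 (hM θ.1 θ.2 h'.1))
      have hfin : (p ⁻¹' {θ.1}).Finite := by
        by_contra hinf
        have h1 : (p ⁻¹' {θ.1}).encard = ⊤ := Set.encard_eq_top_iff.2 hinf
        have h2 := hM θ.1 θ.2 (by rw [h1]; exact le_top)
        rw [← heq, h1] at h2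
        exact not_top_lt h2
      have hfin' : (q ⁻¹' {θ.1}).Finite := by
        rw [← Set.encard_lt_top_iff, ← heq]
        exact Set.encard_lt_top_iff.2 hfin
      have := hfin.to_subtype
      have := hfin'.to_subtype
      refine Finite.card_eq.1 ?_
      rw [Nat.card_coe_set_eq, Nat.card_coe_set_eq, Set.ncard, Set.ncard, heq]
    let e := fun θ => (hfib θ).some
    let e1 : ∀ {δ : Type u} (k : δ → Θ), k ⁻¹' M ≃ Σ θ : M, k ⁻¹' {θ.1} := fun k =>
      { toFun := fun x => ⟨⟨k x.1, x.2⟩, ⟨x.1, rfl⟩⟩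
        invFun := fun x => ⟨x.2.1, by
          have : k x.2.1 = x.1.1 := x.2.2
          rw [Set.mem_preimage, this]
          exact x.1.2⟩
        left_inv := fun x => rfl
        right_inv := by
          rintro ⟨⟨θ, hθ⟩, ⟨x, hx⟩⟩
          obtain rfl : k x = θ := hx
          rfl }
    left
    exact Set.encard_congr ((e1 p).trans ((Equiv.sigmaCongrRight e).trans (e1 q).symm))

variable [L.IsRelational] {S : L.Structure α} {S' : L.Structure β}

theorem HanfEquiv.symm {r t : ℕ} (h : HanfEquiv r t S S') : HanfEquiv r t S' S :=
  fun γ T c => (h γ T c).symm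

theorem HanfEquiv.equipollent_sameType {r t : ℕ} (h : HanfEquiv r t S S') (a : α) :
    EquipollentUpTo t {x | SameType r S a S x} {y | SameType r S a S' y} := by
  have := h _ (restrict S (nbhd S a r)) ⟨a, self_mem_nbhd S a r⟩
  simpa only [nbhdIso_restrict_iff] using this

/-- The `r`-type of a point determines its `r'`-type, so each `r'`-type class is a union of `r`-type
classes. -/
theorem HanfEquiv.mono {r r' t t' : ℕ} (h : HanfEquiv r t S S') (hr : r' ≤ r) (ht : t' ≤ t) :
    HanfEquiv r' t' S S' := by
  intro γ T c
  refine EquipollentUpTo.mono ?_ ht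
  -- The joint equivalence class in both structures serves as a common label for `r`-types.
  let p : α → Set α × Set β := fun a => ({x | SameType r S a S x}, {y | SameType r S a S' y})
  let q : β → Set α × Set β := fun b => ({x | SameType r S' b S x}, {y | SameType r S' b S' y})
  have hpp : ∀ a x, p x = p a ↔ SameType r S a S x := fun a x => by
    constructor
    · intro h
      have : x ∈ (p x).1 := SameType.refl r S x
      rw [h] at this
      exact this
    · intro h
      ext z
      · exact ⟨fun hz => h.trans hz, fun hz => h.symm.trans hz⟩
      · exact ⟨fun hz => h.trans hz, fun hz => h.symm.trans hz⟩
  have hqp : ∀ a y, q y = p a ↔ SameType r S a S' y := fun a y => by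
    constructor
    · intro h
      have : y ∈ (q y).2 := SameType.refl r S' y
      rw [h] at this
      exact this
    · intro h
      ext z
      · exact ⟨fun hz => h.trans hz, fun hz => h.symm.trans hz⟩
      · exact ⟨fun hz => h.trans hz, fun hz => h.symm.trans hz⟩
  have hqq : ∀ b y, q y = q b ↔ SameType r S' b S' y := fun b y => by
    constructor
    · intro h
      have : y ∈ (q y).2 := SameType.refl r S' y
      rw [h] at this
      exact this
    · intro h
      ext z
      · exact ⟨fun hz => h.trans hz, fun hz => h.symm.trans hz⟩
      · exact ⟨fun hz => h.trans hz, fun hz => h.symm.trans hz⟩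
  have hfib : ∀ θ, EquipollentUpTo t (p ⁻¹' {θ}) (q ⁻¹' {θ}) := fun θ => by
    by_cases hα : ∃ a, p a = θ
    · obtain ⟨a, rfl⟩ := hα
      have h1 : p ⁻¹' {p a} = {x | SameType r S a S x} := Set.ext fun x => hpp a x
      have h2 : q ⁻¹' {p a} = {y | SameType r S a S' y} := Set.ext fun y => hqp a y
      rw [h1, h2]
      exact h.equipollent_sameType a
    · by_cases hβ : ∃ b, q b = θ
      · obtain ⟨b, rfl⟩ := hβ
        have h1 : p ⁻¹' {q b} = {x | SameType r S' b S x} := Set.ext fun x =>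
          eq_comm.trans ((hqp x b).trans ⟨SameType.symm, SameType.symm⟩)
        have h2 : q ⁻¹' {q b} = {y | SameType r S' b S' y} := Set.ext fun y => hqq b y
        rw [h1, h2]
        exact (h.symm.equipollent_sameType b).symm
      · left
        have h1 : p ⁻¹' {θ} = ∅ := Set.eq_empty_of_forall_notMem fun x hx => hα ⟨x, hx⟩
        have h2 : q ⁻¹' {θ} = ∅ := Set.eq_empty_of_forall_notMem fun x hx => hβ ⟨x, hx⟩
        rw [h1, h2, Set.encard_empty, Set.encard_empty]
  have key := EquipollentUpTo.preimage hfib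
    (p '' {a | NbhdIso S a r' T c} ∪ q '' {b | NbhdIso S' b r' T c})
  convert key using 1
  · ext x
    constructor
    · exact fun hx => Or.inl ⟨x, hx, rfl⟩
    · rintro (⟨a, ha, hax⟩ | ⟨b, hb, hbx⟩)
      · exact NbhdIso.congr ha (((hpp x a).1 hax).symm.mono hr)
      · exact NbhdIso.congr hb (((hqp x b).1 hbx).symm.mono hr)
  · ext y
    constructor
    · exact fun hx => Or.inr ⟨y, hx, rfl⟩
    · rintro (⟨a, ha, hax⟩ | ⟨b, hb, hbx⟩)
      · exact NbhdIso.congr ha (((hqp a y).1 hax.symm).mono hr)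
      · exact NbhdIso.congr hb (((hqq y b).1 hbx).symm.mono hr)

end Counting

/-! ### The back-and-forth game and Hanf's theorem. -/

section Game

variable {L : FirstOrder.Language.{v, w}} {α β : Type u}

/-- The map `f` restricts to an isomorphism between the `ρ`-balls around `X` and `f '' X`. -/
def IsBallIso (S : L.Structure α) (S' : L.Structure β) (ρ : ℕ) (X : Set α) (f : α → β) : Prop :=
  IsPartialIso S S' (ball S X ρ) (ball S' (f '' X) ρ) f

variable {S : L.Structure α} {S' : L.Structure β}

theorem IsBallIso.mono {ρ ρ' : ℕ} {X : Set α} {f : α → β} (h : IsBallIso S S' ρ X f)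
    (hρ : ρ' ≤ ρ) : IsBallIso S S' ρ' X f :=
  IsPartialIso.ball h (ball_mono S subset_rfl hρ) (ball_mono S' subset_rfl hρ)

theorem IsBallIso.exists_symm [Nonempty α] {ρ : ℕ} {X : Set α} {f : α → β}
    (h : IsBallIso S S' ρ X f) :
    ∃ g : β → α, IsBallIso S' S ρ (f '' X) g ∧ Set.LeftInvOn g f X := by
  obtain ⟨g, hg, hl, -⟩ := IsPartialIso.exists_symm h
  have hl' : Set.LeftInvOn g f X := hl.mono (subset_ball S X ρ)
  refine ⟨g, ?_, hl'⟩
  rw [IsBallIso, hl'.image_image]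
  exact hg

/-- Source of the separation `2 * ρ + 1`: beyond it, no tuple meets both `ρ`-balls. -/
theorem mem_nbhd_of_relMap {a c : α} {ρ n : ℕ} {R : L.Relations n} {x : Fin n → α}
    (h : S.RelMap R x) {i j : Fin n} (hi : x i ∈ nbhd S a ρ) (hj : x j ∈ nbhd S c ρ) :
    c ∈ nbhd S a (2 * ρ + 1) := by
  have := nbhd_trans (nbhd_trans hi (mem_nbhd_one_of_relMap h i j)) (nbhd_symm hj)
  exact nbhd_mono S a (by omega) this

/-- Partial isomorphisms on sets with no relation between them, and with disjoint images with no
relation between them, can be glued. -/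
theorem IsPartialIso.union {X₁ X₂ : Set α} {Y₁ Y₂ : Set β} {f : α → β}
    (h₁ : IsPartialIso S S' X₁ Y₁ f) (h₂ : IsPartialIso S S' X₂ Y₂ f) (hY : Disjoint Y₁ Y₂)
    (hS : ∀ (n : ℕ) (R : L.Relations n) (x : Fin n → α), S.RelMap R x →
      ∀ i j, x i ∈ X₁ → x j ∉ X₂)
    (hS' : ∀ (n : ℕ) (R : L.Relations n) (x : Fin n → β), S'.RelMap R x →
      ∀ i j, x i ∈ Y₁ → x j ∉ Y₂) :
    IsPartialIso S S' (X₁ ∪ X₂) (Y₁ ∪ Y₂) f := by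
  refine ⟨h₁.bijOn.union h₂.bijOn ?_, ?_⟩
  · rintro x (hx | hx) y (hy | hy) hxy
    · exact h₁.bijOn.injOn hx hy hxy
    · have h' := h₂.bijOn.mapsTo hy
      rw [← hxy] at h'
      exact (Set.disjoint_left.1 hY (h₁.bijOn.mapsTo hx) h').elim
    · have h' := h₂.bijOn.mapsTo hx
      rw [hxy] at h'
      exact (Set.disjoint_left.1 hY (h₁.bijOn.mapsTo hy) h').elim
    · exact h₂.bijOn.injOn hx hy hxy
  · intro n R x hx
    by_cases hx1 : ∀ i, x i ∈ X₁
    · exact h₁.rel n R x hx1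
    · by_cases hx2 : ∀ i, x i ∈ X₂
      · exact h₂.rel n R x hx2
      · push Not at hx1 hx2
        obtain ⟨i, hi⟩ := hx1
        obtain ⟨j, hj⟩ := hx2
        have hi' := (hx i).resolve_left hi
        have hj' := (hx j).resolve_right hj
        exact iff_of_false (fun h => hS n R x h j i hj' hi')
          (fun h => hS' n R _ h j i (h₁.bijOn.mapsTo hj') (h₂.bijOn.mapsTo hi'))

theorem ball_insert (S : L.Structure α) (X : Set α) (c : α) (ρ : ℕ) :
    ball S (insert c X) ρ = ball S X ρ ∪ nbhd S c ρ := by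
  ext b
  constructor
  · rintro ⟨a, rfl | ha, hb⟩
    · exact Or.inr hb
    · exact Or.inl ⟨a, ha, hb⟩
  · rintro (⟨a, ha, hb⟩ | hb)
    · exact ⟨a, Or.inr ha, hb⟩
    · exact ⟨c, Or.inl rfl, hb⟩

theorem nbhd_subset_ball {X : Set α} {a : α} {ρ σ τ : ℕ} (ha : a ∈ ball S X σ) (h : σ + ρ ≤ τ) :
    nbhd S a ρ ⊆ ball S X τ := by
  obtain ⟨x, hx, hax⟩ := ha
  exact fun b hb => ⟨x, hx, nbhd_mono S x h (nbhd_trans hax hb)⟩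

theorem not_mem_ball_of_relMap {X : Set α} {c : α} {ρ n : ℕ} (hc : c ∉ ball S X (2 * ρ + 1))
    {R : L.Relations n} {x : Fin n → α} (h : S.RelMap R x) (i j : Fin n)
    (hi : x i ∈ ball S X ρ) : x j ∉ nbhd S c ρ := by
  obtain ⟨a, ha, hi⟩ := hi
  exact fun hj => hc ⟨a, ha, mem_nbhd_of_relMap h hi hj⟩

theorem disjoint_ball_nbhd {X : Set α} {c : α} {ρ : ℕ} (hc : c ∉ ball S X (2 * ρ + 1)) :
    Disjoint (ball S X ρ) (nbhd S c ρ) := by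
  rw [Set.disjoint_left]
  rintro b ⟨a, ha, hab⟩ hcb
  exact hc ⟨a, ha, nbhd_mono S a (by omega) (nbhd_trans hab (nbhd_symm hcb))⟩

variable [L.IsRelational]

/-- One round of the game: a ball isomorphism extends to a further point. -/
theorem IsBallIso.extend {ρ t n d : ℕ} {X : Set α} {f : α → β}
    (hf : IsBallIso S S' (3 * ρ + 1) X f) (hX : X.encard ≤ n) (hd : DegreeBounded S' d)
    (h : HanfEquiv ρ t S S') (ht : n * (d + 1) ^ (2 * ρ + 1) < t) (c : α) :
    ∃ f' : α → β, Set.EqOn f f' X ∧ IsBallIso S S' ρ (insert c X) f' := by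
  classical
  have hmaps : ∀ x ∈ ball S X (2 * ρ + 1), f x ∈ ball S' (f '' X) (2 * ρ + 1) :=
    fun x hx => (hf.mono (by omega : 2 * ρ + 1 ≤ 3 * ρ + 1)).bijOn.mapsTo hx
  -- A near point has its `ρ`-ball inside the `(3 * ρ + 1)`-ball of `X`, where `f` is already
  -- defined; a far point needs a far partner of the same type.
  by_cases hc : c ∈ ball S X (2 * ρ + 1)
  · refine ⟨f, fun _ _ => rfl, IsPartialIso.ball hf ?_ ?_⟩
    · rw [ball_insert]
      exact Set.union_subset (ball_mono S subset_rfl (by omega)) (nbhd_subset_ball hc (by omega))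
    · rw [Set.image_insert_eq, ball_insert]
      exact Set.union_subset (ball_mono S' subset_rfl (by omega))
        (nbhd_subset_ball (hmaps c hc) (by omega))
  · obtain ⟨c', hcc', hc'⟩ : ∃ c', SameType ρ S c S' c' ∧ c' ∉ ball S' (f '' X) (2 * ρ + 1) := by
      by_contra hcon
      push Not at hcon
      have hball : (ball S' (f '' X) (2 * ρ + 1)).encard ≤ (n * (d + 1) ^ (2 * ρ + 1) : ℕ) :=
        hd.encard_ball_le ((Set.encard_image_le f X).trans hX) _
      have hsmall : {y | SameType ρ S c S' y}.encard ≤ (n * (d + 1) ^ (2 * ρ + 1) : ℕ) :=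
        (Set.encard_le_encard hcon).trans hball
      -- If all partners were near, they would number fewer than `t`, so the two classes would have
      -- equal finite size. Pulling back along `f` then exhausts the class in `S` by near points,
      -- contradicting that `c` is far.
      have heq : {x | SameType ρ S c S x}.encard = {y | SameType ρ S c S' y}.encard :=
        (h.equipollent_sameType c).elim id fun h' => by
          have := h'.2.trans hsmall
          exact absurd (by exact_mod_cast this) (not_le.2 ht)
      have hfin : {x | SameType ρ S c S x}.Finite :=
        Set.finite_of_encard_le_coe (heq.trans_le hsmall)
      have hsub : {y | SameType ρ S c S' y} ⊆
          f '' ({x | SameType ρ S c S x} ∩ ball S X (2 * ρ + 1)) := by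
        intro y hy
        obtain ⟨x, hx, rfl⟩ :=
          (hf.mono (by omega : 2 * ρ + 1 ≤ 3 * ρ + 1)).bijOn.surjOn (hcon y hy)
        have hxy : SameType ρ S x S' (f x) :=
          ⟨f, IsPartialIso.nbhd hf (nbhd_subset_ball hx (by omega))
            (nbhd_subset_ball (hmaps x hx) (by omega)), rfl⟩
        exact ⟨x, ⟨SameType.trans hy hxy.symm, hx⟩, rfl⟩
      have hle : {x | SameType ρ S c S x}.encard ≤
          ({x | SameType ρ S c S x} ∩ ball S X (2 * ρ + 1)).encard :=
        heq.trans_le ((Set.encard_le_encard hsub).trans (Set.encard_image_le _ _))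
      have := hfin.eq_of_subset_of_encard_le' Set.inter_subset_left hle
      have hmem : c ∈ {x | SameType ρ S c S x} ∩ ball S X (2 * ρ + 1) := by
        rw [this]
        exact SameType.refl ρ S c
      exact hc hmem.2
    obtain ⟨g, hg, hgc⟩ := hcc'
    have hdis := disjoint_ball_nbhd hc
    let f' : α → β := (ball S X ρ).piecewise f g
    have h1 : Set.EqOn f f' (ball S X ρ) := fun x hx => by simp [f', hx]
    have h2 : Set.EqOn g f' (nbhd S c ρ) := fun x hx => by
      simp [f', Set.disjoint_right.1 hdis hx]
    have hX' : Set.EqOn f f' X := h1.mono (subset_ball S X ρ)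
    refine ⟨f', hX', ?_⟩
    rw [IsBallIso, Set.image_insert_eq, ball_insert, ball_insert, ← hX'.image_eq,
      ← h2 (self_mem_nbhd S c ρ), hgc]
    refine IsPartialIso.union ((hf.mono (by omega)).congr h1) (hg.congr h2)
      (disjoint_ball_nbhd hc') ?_ ?_
    · exact fun m R x hR i j hi => not_mem_ball_of_relMap hc hR i j hi
    · exact fun m R x hR i j hi => not_mem_ball_of_relMap hc' hR i j hi

/-- Only some map `α → β` is required; a positive threshold supplies one by forcing a type realized
in `S` to occur in `S'`. -/
theorem HanfEquiv.isBallIso_empty [Nonempty α] {r t : ℕ} (h : HanfEquiv r t S S') (ht : 0 < t)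
    (ρ : ℕ) : ∃ f : α → β, IsBallIso S S' ρ ∅ f := by
  obtain ⟨a⟩ := ‹Nonempty α›
  obtain ⟨b, hb⟩ : {y | SameType r S a S' y}.Nonempty := by
    have ha : {x | SameType r S a S x}.encard ≠ 0 :=
      Set.encard_ne_zero.2 ⟨a, SameType.refl r S a⟩
    rcases h.equipollent_sameType a with h' | h'
    · rw [h'] at ha
      exact Set.encard_ne_zero.1 ha
    · refine Set.encard_ne_zero.1 fun h0 => ?_
      have := h'.2
      rw [h0] at this
      exact absurd (by exact_mod_cast this) (not_le.2 ht)
  obtain ⟨f, hf, -⟩ := hb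
  refine ⟨f, ?_⟩
  have h0 : ∀ {δ : Type u} (T : L.Structure δ), ball T ∅ ρ = ∅ := fun T =>
    Set.eq_empty_of_forall_notMem fun _ ⟨_, h, _⟩ => h
  have := hf.mono (Set.empty_subset _)
  rw [IsBallIso, Set.image_empty, h0, h0]
  rwa [Set.image_empty] at this

/-- Hanf-equivalent structures of bounded degree have the same balls around few points. -/
theorem exists_isBallIso_of_hanfEquiv (L : FirstOrder.Language.{v, w}) [L.IsRelational]
    (d ρ m : ℕ) : ∃ r t : ℕ, ∀ (α β : Type u) (S : L.Structure α) (S' : L.Structure β), Nonempty α →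
      DegreeBounded S' d → HanfEquiv r t S S' → ∀ E : Finset α, E.card ≤ m →
        ∃ f : α → β, IsBallIso S S' ρ E f := by
  classical
  induction m generalizing ρ with
  | zero =>
    refine ⟨0, 1, fun α β S S' _ _ h E hE => ?_⟩
    rw [Finset.card_eq_zero.1 (Nat.le_zero.1 hE), Finset.coe_empty]
    exact h.isBallIso_empty Nat.one_pos ρ
  | succ m ih =>
    obtain ⟨r, t, hrt⟩ := ih (3 * ρ + 1)
    refine ⟨max r ρ, max t (m * (d + 1) ^ (2 * ρ + 1) + 1), fun α β S S' hα hd h E hE => ?_⟩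
    have hih := hrt α β S S' hα hd (h.mono (le_max_left _ _) (le_max_left _ _))
    rcases E.eq_empty_or_nonempty with rfl | ⟨c, hc⟩
    · obtain ⟨f, hf⟩ := hih ∅ (by simp)
      exact ⟨f, hf.mono (by omega)⟩
    · have hcard : (E.erase c).card ≤ m := by
        rw [Finset.card_erase_of_mem hc]
        omega
      obtain ⟨f, hf⟩ := hih (E.erase c) hcard
      obtain ⟨f', -, hf'⟩ := hf.extend (n := m)
        (by rw [Set.encard_coe_eq_coe_finsetCard]; exact_mod_cast hcard) hd
        (h.mono (le_max_right _ _) (le_max_right _ _)) (Nat.lt_succ_self _) c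
      rw [← Finset.coe_insert, Finset.insert_erase hc] at hf'
      exact ⟨f', hf'⟩

/-- Hanf's theorem for formulas on structures of bounded degree. -/
theorem exists_realize_of_hanfEquiv (d : ℕ) {n : ℕ} (φ : L.BoundedFormula Empty n) :
    ∃ ρ r t : ℕ, ∀ (α β : Type u) (S : L.Structure α) (S' : L.Structure β), Nonempty α →
      Nonempty β → DegreeBounded S d → DegreeBounded S' d → HanfEquiv r t S S' →
        ∀ (x : Fin n → α) (f : α → β), IsBallIso S S' ρ (Set.range x) f →
          @FirstOrder.Language.BoundedFormula.Realize L α S Empty n φ Empty.elim x →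
          @FirstOrder.Language.BoundedFormula.Realize L β S' Empty n φ Empty.elim (f ∘ x) := by
  have hterm : ∀ {m : ℕ} (s : L.Term (Empty ⊕ Fin m)), ∃ i, s = .var (Sum.inr i) := fun s => by
    cases s with
    | var z =>
      cases z with
      | inl e => exact e.elim
      | inr i => exact ⟨i, rfl⟩
    | func F _ => exact isEmptyElim F
  induction φ with
  | falsum => exact ⟨0, 0, 0, fun α β S S' _ _ _ _ _ x f _ h => h.elim⟩
  | @equal n s₁ s₂ =>
    obtain ⟨i, rfl⟩ := hterm s₁
    obtain ⟨j, rfl⟩ := hterm s₂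
    refine ⟨0, 0, 0, fun α β S S' _ _ _ _ _ x f _ h => ?_⟩
    have h' : x i = x j := h
    exact congrArg f h'
  | @rel n l R ts =>
    choose i hi using fun k => hterm (ts k)
    obtain rfl : ts = fun k => .var (Sum.inr (i k)) := funext hi
    refine ⟨0, 0, 0, fun α β S S' _ _ _ _ _ x f hf h => ?_⟩
    have h' : S.RelMap R (x ∘ i) := h
    exact (IsPartialIso.rel hf l R (x ∘ i) fun k => subset_ball _ _ _ ⟨i k, rfl⟩).1 h'
  | @imp n φ ψ ihφ ihψ =>
    obtain ⟨ρ₁, r₁, t₁, h₁⟩ := ihφ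
    obtain ⟨ρ₂, r₂, t₂, h₂⟩ := ihψ
    refine ⟨max ρ₁ ρ₂, max r₁ r₂, max t₁ t₂, fun α β S S' hα hβ hS hS' h x f hf hx => ?_⟩
    intro hφ
    -- The induction hypothesis transfers truth one way only, so the premise is pulled back along
    -- the inverse.
    obtain ⟨g, hg, hgf⟩ := hf.exists_symm
    rw [← Set.range_comp] at hg
    have hx' : g ∘ f ∘ x = x := funext fun i => hgf ⟨i, rfl⟩
    have h3 := h₁ β α S' S hβ hα hS' hS (h.symm.mono (le_max_left _ _) (le_max_left _ _)) (f ∘ x) g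
      (hg.mono (le_max_left _ _)) hφ
    rw [hx'] at h3
    exact h₂ α β S S' hα hβ hS hS' (h.mono (le_max_right _ _) (le_max_right _ _)) x f
      (hf.mono (le_max_right _ _)) (hx h3)
  | @all n φ ih =>
    obtain ⟨ρ, r, t, ih⟩ := ih
    refine ⟨3 * ρ + 1, max r ρ, max t (n * (d + 1) ^ (2 * ρ + 1) + 1),
      fun α β S S' hα hβ hS hS' h x f hf hx => ?_⟩
    intro b
    obtain ⟨g, hg, hgf⟩ := hf.exists_symm
    rw [← Set.range_comp] at hg
    have hcard : (Set.range (f ∘ x)).encard ≤ n := by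
      rw [← Set.image_univ]
      refine (Set.encard_image_le _ _).trans ?_
      simp
    -- The challenge `b` lies in `β`, so it is the inverse map that is extended, then inverted
    -- again.
    obtain ⟨g', hgg', hg'⟩ := hg.extend hcard hS
      (h.symm.mono (le_max_right _ _) (le_max_right _ _)) (Nat.lt_succ_self _) b
    obtain ⟨f', hf', hfg'⟩ := hg'.exists_symm
    have hg'x : ∀ i, g' (f (x i)) = x i := fun i =>
      (hgg' ⟨i, rfl⟩).symm.trans (hgf ⟨i, rfl⟩)
    have hrange : g' '' insert b (Set.range (f ∘ x)) =
        Set.range (Fin.snoc x (g' b) : Fin (n + 1) → α) := by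
      rw [Set.image_insert_eq, ← Set.range_comp, Fin.range_snoc]
      congr 2
      exact funext hg'x
    rw [hrange] at hf'
    have key := ih α β S S' hα hβ hS hS' (h.mono (le_max_left _ _) (le_max_left _ _)) _ f' hf'
      (hx (g' b))
    have hcomp : f' ∘ (Fin.snoc x (g' b) : Fin (n + 1) → α) = Fin.snoc (f ∘ x) b := by
      rw [Fin.comp_snoc, hfg' (Set.mem_insert _ _)]
      congr 1
      funext i
      have := hfg' (Set.mem_insert_of_mem b (Set.mem_range_self (f := f ∘ x) i))
      simpa [hg'x] using this
    rw [hcomp] at key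
    exact key

/-- Hanf's theorem for sentences on structures of bounded degree. -/
theorem exists_sat_iff_of_hanfEquiv (d : ℕ) (φ : L.Sentence) :
    ∃ r t : ℕ, ∀ (α β : Type u) (S : L.Structure α) (S' : L.Structure β), Nonempty α →
      Nonempty β → DegreeBounded S d → DegreeBounded S' d → HanfEquiv r t S S' →
        (Sat S φ ↔ Sat S' φ) := by
  obtain ⟨ρ, r, t, hφ⟩ := exists_realize_of_hanfEquiv.{u} d φ
  -- The threshold `t + 1` is positive, as the opening position of the game demands.
  have key : ∀ (α β : Type u) (S : L.Structure α) (S' : L.Structure β), Nonempty α →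
      Nonempty β → DegreeBounded S d → DegreeBounded S' d → HanfEquiv r (t + 1) S S' →
        Sat S φ → Sat S' φ := by
    intro α β S S' hα hβ hS hS' h hsat
    obtain ⟨f, hf⟩ := h.isBallIso_empty (Nat.succ_pos t) ρ
    have he : ∀ {δ : Type u} (v : Empty → δ), v = Empty.elim := fun v => funext fun e => e.elim
    have h0 : ∀ {δ : Type u} (x y : Fin 0 → δ), x = y := fun x y => funext fun i => i.elim0
    have := hφ α β S S' hα hβ hS hS' (h.mono le_rfl (Nat.le_succ t)) Fin.elim0 f
      (by rwa [Set.range_eq_empty])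
    unfold Sat FirstOrder.Language.Sentence.Realize FirstOrder.Language.Formula.Realize at *
    rw [he default, h0 default Fin.elim0] at hsat
    rw [he default, h0 default (f ∘ Fin.elim0)]
    exact this hsat
  exact ⟨r, t + 1, fun α β S S' hα hβ hS hS' h => ⟨key α β S S' hα hβ hS hS' h,
    key β α S' S hβ hα hS' hS h.symm⟩⟩

end Game

/-! ### Finitely many neighbourhood types under a size bound. -/

section FinitelyManyTypes

/-- Pointed `L`-structures with a standard universe of at most `N` elements. -/
abbrev PointedStructure (L : FirstOrder.Language.{v, w}) (N : ℕ) : Type (max u v w) :=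
  Σ n : Fin (N + 1), L.Structure (ULift.{u} (Fin n)) × ULift.{u} (Fin n)

variable {L : FirstOrder.Language.{v, w}} [L.IsRelational]

theorem finite_structure (hL : Finite (Σ n, L.Relations n)) (X : Type*) [Finite X] :
    Finite (L.Structure X) := by
  refine Finite.of_injective
    (fun (S : L.Structure X) (s : Σ n, L.Relations n) => (S.RelMap s.2 : (Fin s.1 → X) → Prop)) ?_
  intro S T h
  ext n
  · exact isEmptyElim (‹L.Functions n›)
  · rename_i R x
    exact iff_of_eq (congrFun (congrFun h ⟨n, R⟩) x)

theorem finite_pointedStructure (hL : Finite (Σ n, L.Relations n)) (N : ℕ) :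
    Finite (PointedStructure.{u} L N) := by
  have := fun n => finite_structure hL (ULift.{u} (Fin n))
  infer_instance

theorem exists_pointedStructure {α : Type u} {S : L.Structure α} {a : α} {r N : ℕ}
    (h : (nbhd S a r).encard ≤ N) :
    ∃ τ : PointedStructure.{u} L N, NbhdIso S a r τ.2.1 τ.2.2 := by
  have hfin : (nbhd S a r).Finite := Set.finite_of_encard_le_coe h
  have := hfin.to_subtype
  have hcard : Nat.card (nbhd S a r) < N + 1 := by
    rw [Nat.card_coe_set_eq]
    refine Nat.lt_succ_of_le ?_
    rw [← hfin.cast_ncard_eq] at h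
    exact_mod_cast h
  let e : nbhd S a r ≃ ULift.{u} (Fin (Nat.card (nbhd S a r))) :=
    (Finite.equivFin _).trans Equiv.ulift.symm
  let _ := restrict S (nbhd S a r)
  exact ⟨⟨⟨_, hcard⟩, e.inducedStructure, e ⟨a, self_mem_nbhd S a r⟩⟩,
    e.inducedStructureEquiv, rfl⟩

/-- Every realized type has a representative on a standard universe, and unrealized types have count
zero on both sides. -/
theorem hanfEquiv_of_pointedStructure {α β : Type u} [Finite α] [Finite β] {S : L.Structure α}
    {S' : L.Structure β} {r t N : ℕ} (hS : ∀ a, (nbhd S a r).encard ≤ N)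
    (hS' : ∀ b, (nbhd S' b r).encard ≤ N)
    (h : ∀ τ : PointedStructure.{u} L N, min t {a | NbhdIso S a r τ.2.1 τ.2.2}.ncard =
      min t {b | NbhdIso S' b r τ.2.1 τ.2.2}.ncard) : HanfEquiv r t S S' := by
  have key : ∀ τ : PointedStructure.{u} L N, EquipollentUpTo t {a | NbhdIso S a r τ.2.1 τ.2.2}
      {b | NbhdIso S' b r τ.2.1 τ.2.2} := fun τ => by
    have hτ := h τ
    rw [EquipollentUpTo, ← (Set.toFinite {a | NbhdIso S a r τ.2.1 τ.2.2}).cast_ncard_eq,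
      ← (Set.toFinite {b | NbhdIso S' b r τ.2.1 τ.2.2}).cast_ncard_eq]
    norm_cast
    omega
  intro γ T c
  by_cases hα : ∃ a, NbhdIso S a r T c
  · obtain ⟨a, ha⟩ := hα
    obtain ⟨τ, hτ⟩ := exists_pointedStructure (hS a)
    convert key τ using 1
    · ext x
      exact ⟨fun hx => hτ.congr (ha.sameType hx), fun hx => ha.congr (hτ.sameType hx)⟩
    · ext x
      exact ⟨fun hx => hτ.congr (ha.sameType hx), fun hx => ha.congr (hτ.sameType hx)⟩
  · by_cases hβ : ∃ b, NbhdIso S' b r T c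
    · obtain ⟨b, hb⟩ := hβ
      obtain ⟨τ, hτ⟩ := exists_pointedStructure (hS' b)
      convert key τ using 1
      · ext x
        exact ⟨fun hx => hτ.congr (hb.sameType hx), fun hx => hb.congr (hτ.sameType hx)⟩
      · ext x
        exact ⟨fun hx => hτ.congr (hb.sameType hx), fun hx => hb.congr (hτ.sameType hx)⟩
    · left
      push Not at hα hβ
      simp [hα, hβ]

end FinitelyManyTypes

/-! ### Transferring presentations between structures. -/

section Schemes

variable {L : FirstOrder.Language.{v, w}} {k : ℕ} {K : StructClass.{u} L}
  {P : StructClass.{u} (withRel L k)} {α β : Type u}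

theorem nbhd_subset_nbhd_mul {S : L.Structure α} {A : (withRel L k).Structure α} {ν : ℕ}
    (h : ∀ a, nbhd A a 1 ⊆ nbhd S a ν) (a : α) (r : ℕ) : nbhd A a r ⊆ nbhd S a (ν * r) := by
  induction r with
  | zero => rw [nbhd_zero, mul_zero, nbhd_zero]
  | succ r ih =>
    intro b hb
    obtain ⟨c, hc, hb⟩ := mem_nbhd_succ.1 hb
    exact nbhd_trans (ih hc) (h c hb)

theorem DegreeBounded.of_nbhd_subset {S : L.Structure α} {A : (withRel L k).Structure α} {d ν : ℕ}
    (hS : DegreeBounded S d) (h : ∀ a, nbhd A a 1 ⊆ nbhd S a ν) :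
    DegreeBounded A ((d + 1) ^ ν) := fun a =>
  (Set.encard_le_encard fun _ hb => h a (mem_nbhd_one.2 (Or.inr hb))).trans
    (hS.encard_nbhd_le a ν)

theorem finite_relations_withRel [Finite L.Symbols] (k : ℕ) :
    Finite (Σ n, (withRel L k).Relations n) := by
  have h1 : Finite (Σ n, L.Relations n) :=
    Finite.of_injective (fun R => (Sum.inr R : L.Symbols)) Sum.inr_injective
  refine Finite.of_surjective (α := Option (Σ n, L.Relations n))
    (fun o => o.elim ⟨k, Sum.inr ⟨rfl⟩⟩ fun R => ⟨R.1, Sum.inl R.2⟩) ?_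
  rintro ⟨n, R | R⟩
  · exact ⟨some ⟨n, R⟩, rfl⟩
  · obtain ⟨rfl⟩ : PLift (n = k) := R
    exact ⟨none, rfl⟩

variable [L.IsRelational]

theorem IsPartialIso.sat_iff {M : FirstOrder.Language.{v, w}} [M.IsRelational] {S : M.Structure α}
    {S' : M.Structure β} {f : α → β} (hf : IsPartialIso S S' Set.univ Set.univ f)
    (φ : M.Sentence) : Sat S φ ↔ Sat S' φ := by
  let e : α ≃[M] β :=
    { Equiv.ofBijective f (Set.bijOn_univ.1 hf.bijOn) with
      map_fun' := fun F => isEmptyElim F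
      map_rel' := fun R x => (hf.rel _ R x fun _ => Set.mem_univ _).symm }
  exact Language.StrongHomClass.realize_sentence e φ

/-- Elementarity enters only here, as invariance of the scheme under isomorphism. -/
theorem IsElementaryScheme.presents_of_isPartialIso (helem : IsElementaryScheme P K)
    {S : L.Structure α} {S₂ : L.Structure β} (hS : K α S) (hS₂ : K β S₂)
    {A : (withRel L k).Structure α} {B : (withRel L k).Structure β} {f : α → β}
    (hf : IsPartialIso A B Set.univ Set.univ f) (hA : Presents P A S) (hB : reduct B = S₂) :
    Presents P B S₂ := by
  obtain ⟨θ, hθ⟩ := helem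
  exact ⟨(hθ β S₂ hS₂ B hB).2 ((hf.sat_iff θ).1 ((hθ α S hS A hA.2).1 hA.1)), hB⟩

/-- A presentation of a nonempty substructure extends to a presentation of the whole structure. -/
theorem exists_presents_restrict_eq (hsub : SubstructureClosed K) (hP : IsPresentationScheme P K)
    (helem : IsElementaryScheme P K) (hloc : HasDisjointLocalAmalgamation P K)
    {S : L.Structure α} (hS : K α S) [Finite α] {V : Set α} (hV : V.Nonempty)
    {B : (withRel L k).Structure V} (hB : Presents P B (restrict S V)) :
    ∃ A : (withRel L k).Structure α, Presents P A S ∧ restrict A V = B := by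
  -- Amalgamation needs a nonempty second set. A singleton outside `V` serves; if there is none, the
  -- presentation is moved along the identification of `Set.univ` with `α`.
  by_cases hVu : V = Set.univ
  · subst hVu
    let A : (withRel L k).Structure α :=
      { funMap := fun F _ => isEmptyElim F
        RelMap := fun R x => B.RelMap R fun i => ⟨x i, trivial⟩ }
    have hAB : restrict A Set.univ = B := by
      ext n F x
      · exact isEmptyElim F
      · rfl
    refine ⟨A, helem.presents_of_isPartialIso (hsub α S hS _ hV) hS
      (hAB ▸ isPartialIso_restrict A Set.univ) hB ?_, hAB⟩
    ext n R x
    · exact isEmptyElim R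
    · have h : (reduct B).RelMap R (fun i => (⟨x i, trivial⟩ : (Set.univ : Set α))) ↔
          (restrict S Set.univ).RelMap R (fun i => (⟨x i, trivial⟩ : (Set.univ : Set α))) := by
        rw [hB.2]
      exact h
  · obtain ⟨c, hc⟩ := (Set.ne_univ_iff_exists_notMem V).1 hVu
    obtain ⟨C, hC⟩ := hP.2 _ _ (hsub α S hS {c} (Set.singleton_nonempty c))
    obtain ⟨A, hA, hAB, -⟩ := hloc α S hS V {c} hV (Set.singleton_nonempty c) V.toFinite
      (Set.toFinite _) (Set.disjoint_singleton_right.2 hc) B C hB hC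
    exact ⟨A, hA, hAB⟩

/-- Along a partial isomorphism, part of a presentation of one structure is carried over to a
presentation of another. -/
theorem exists_presents_isPartialIso (hsub : SubstructureClosed K) (hP : IsPresentationScheme P K)
    (helem : IsElementaryScheme P K) (hloc : IsLocalScheme P K) {S : L.Structure α}
    {S' : L.Structure β} (hS : K α S) (hS' : K β S') [Finite α] [Finite β] {U : Set α} {V : Set β}
    (hU : U.Nonempty) {f : α → β} (hf : IsPartialIso S S' U V f) {A : (withRel L k).Structure α}
    (hA : Presents P A S) :
    ∃ B : (withRel L k).Structure β, Presents P B S' ∧ IsPartialIso A B U V f := by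
  let e : U ≃ V := Set.BijOn.equiv f hf.bijOn
  let C : (withRel L k).Structure V :=
    { funMap := fun F _ => isEmptyElim F
      RelMap := fun R y => A.RelMap R fun i => (e.symm (y i) : α) }
  have hV : V.Nonempty := let ⟨x, hx⟩ := hU; ⟨f x, hf.bijOn.mapsTo hx⟩
  have hAC : IsPartialIso (restrict A U) C Set.univ Set.univ e :=
    ⟨Set.bijOn_univ.2 e.bijective, fun n R x _ => by
      change A.RelMap R _ ↔ A.RelMap R _
      simp⟩
  have hC : reduct C = restrict S' V := by
    ext n R y
    · exact isEmptyElim R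
    · have h := hf.rel n R (fun i => (e.symm (y i) : α)) fun i => (e.symm (y i)).2
      rw [← hA.2] at h
      have hy : (f ∘ fun i => (e.symm (y i) : α)) = fun i => (y i : β) :=
        funext fun i => congrArg Subtype.val (e.apply_symm_apply (y i))
      rw [hy] at h
      exact h
  obtain ⟨B, hB, hBC⟩ := exists_presents_restrict_eq hsub hP helem hloc.2 hS' hV
    (helem.presents_of_isPartialIso (hsub α S hS U hU) (hsub β S' hS' V hV) hAC
      (hloc.1 α S hS A hA U hU U.toFinite) hC)
  refine ⟨B, hB, hf.bijOn, fun n R x hx => ?_⟩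
  rw [← hBC] at hAC
  exact hAC.rel n R (fun i => ⟨x i, hx i⟩) fun _ => Set.mem_univ _

/-- Some presentation of `S'` realizes each type of neighbourhoods at least as often, up to a
threshold, as a given presentation of `S`. -/
theorem exists_presents_ncard_le (hsub : SubstructureClosed K) (hP : IsPresentationScheme P K)
    (helem : IsElementaryScheme P K) (hloc : IsLocalScheme P K) {ν : ℕ}
    (hν : ∀ (α : Type u) (S : L.Structure α), K α S → ∀ A : (withRel L k).Structure α,
      Presents P A S → ∀ a : α, nbhd A a 1 ⊆ nbhd S a ν) {ι : Type*} [Fintype ι] {Γ : ι → Type u}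
    (T : ∀ i, (withRel L k).Structure (Γ i)) (c : ∀ i, Γ i) {r t : ℕ}
    {S : L.Structure α} {S' : L.Structure β} (hS : K α S) (hS' : K β S') [Finite α] [Nonempty α]
    [Finite β]
    (hiso : ∀ E : Finset α, E.card ≤ Fintype.card ι * t + 1 →
      ∃ f : α → β, IsBallIso S S' (ν * r) E f)
    {A : (withRel L k).Structure α} (hA : Presents P A S) :
    ∃ B : (withRel L k).Structure β, Presents P B S' ∧
      ∀ i, min t {a | NbhdIso A a r (T i) (c i)}.ncard ≤
        min t {b | NbhdIso B b r (T i) (c i)}.ncard := by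
  classical
  have hE : ∀ i, ∃ E : Finset α, ↑E ⊆ {a | NbhdIso A a r (T i) (c i)} ∧
      E.card = min t {a | NbhdIso A a r (T i) (c i)}.ncard := fun i => by
    have hfin := Set.toFinite {a | NbhdIso A a r (T i) (c i)}
    obtain ⟨E, hE, hcard⟩ := Finset.exists_subset_card_eq (s := hfin.toFinset)
      (n := min t {a | NbhdIso A a r (T i) (c i)}.ncard)
      (by rw [← Set.ncard_eq_toFinset_card _ hfin]; exact min_le_right _ _)
    exact ⟨E, fun a ha => hfin.mem_toFinset.1 (hE ha), hcard⟩
  choose E hEsub hEcard using hE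
  obtain ⟨a₀⟩ := ‹Nonempty α›
  -- The extra point `a₀` keeps the copied substructure nonempty when no type is realized.
  have hcard : (insert a₀ (Finset.univ.biUnion E)).card ≤ Fintype.card ι * t + 1 := by
    refine (Finset.card_insert_le _ _).trans (Nat.succ_le_succ ?_)
    exact Finset.card_biUnion_le_card_mul _ _ _ fun i _ => (hEcard i).trans_le (min_le_left _ _)
  obtain ⟨f, hf⟩ := hiso _ hcard
  obtain ⟨B, hB, hAB⟩ := exists_presents_isPartialIso hsub hP helem hloc hS hS'
    ⟨a₀, subset_ball S _ _ (Finset.mem_coe.2 (Finset.mem_insert_self _ _))⟩ hf hA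
  refine ⟨B, hB, fun i => le_min (min_le_left _ _) ?_⟩
  have hmem : ∀ a ∈ E i, a ∈ insert a₀ (Finset.univ.biUnion E) := fun a ha =>
    Finset.mem_insert_of_mem (Finset.mem_biUnion.2 ⟨i, Finset.mem_univ i, ha⟩)
  have hinj : Set.InjOn f (E i) := hf.bijOn.injOn.mono fun a ha =>
    subset_ball S _ _ (Finset.mem_coe.2 (hmem a ha))
  rw [← hEcard i, ← Set.ncard_coe_finset, ← hinj.ncard_image]
  refine Set.ncard_le_ncard ?_ (Set.toFinite _)
  rintro _ ⟨a, ha, rfl⟩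
  have hN : nbhd A a r ⊆ ball S ↑(insert a₀ (Finset.univ.biUnion E)) (ν * r) := fun x hx =>
    ⟨a, Finset.mem_coe.2 (hmem a ha), nbhd_subset_nbhd_mul (hν α S hS A hA) a r hx⟩
  have hN' : nbhd B (f a) r ⊆ ball S' (f '' ↑(insert a₀ (Finset.univ.biUnion E))) (ν * r) :=
    fun x hx => ⟨f a, ⟨a, Finset.mem_coe.2 (hmem a ha), rfl⟩,
      nbhd_subset_nbhd_mul (hν β S' hS' B hB) (f a) r hx⟩
  exact NbhdIso.congr (hEsub i ha) ⟨f, hAB.nbhd hN hN', rfl⟩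

/-- Hanf-equivalent members of `K` of bounded degree have Hanf-equivalent presentations. -/
theorem exists_presents_hanfEquiv [Finite L.Symbols]
    (hfin : ∀ (α : Type u) (S : L.Structure α), K α S → Finite α ∧ Nonempty α)
    (hsub : SubstructureClosed K) (hP : IsPresentationScheme P K)
    (helem : IsElementaryScheme P K) (hloc : IsLocalScheme P K) {ν : ℕ}
    (hν : ∀ (α : Type u) (S : L.Structure α), K α S → ∀ A : (withRel L k).Structure α,
      Presents P A S → ∀ a : α, nbhd A a 1 ⊆ nbhd S a ν) (d r t : ℕ) :
    ∃ r' t' : ℕ, ∀ (α β : Type u) (S : L.Structure α) (S' : L.Structure β), K α S → K β S' →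
      DegreeBounded S d → DegreeBounded S' d → HanfEquiv r' t' S S' →
        ∃ (A : (withRel L k).Structure α) (B : (withRel L k).Structure β),
          Presents P A S ∧ Presents P B S' ∧ HanfEquiv r t A B := by
  classical
  -- Presentations have degree at most `(d + 1) ^ ν`, so `N` bounds their `r`-neighbourhoods.
  let N := ((d + 1) ^ ν + 1) ^ r
  have := finite_pointedStructure.{u} (finite_relations_withRel (L := L) k) N
  have := Fintype.ofFinite (PointedStructure.{u} (withRel L k) N)
  obtain ⟨r', t', hiso⟩ := exists_isBallIso_of_hanfEquiv.{u} L d (ν * r)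
    (Fintype.card (PointedStructure.{u} (withRel L k) N) * t + 1)
  refine ⟨r', t', fun α β S S' hS hS' hd hd' h => ?_⟩
  obtain ⟨_, _⟩ := hfin α S hS
  obtain ⟨_, _⟩ := hfin β S' hS'
  let count : ∀ {δ : Type u}, (withRel L k).Structure δ →
      PointedStructure.{u} (withRel L k) N → ℕ :=
    fun A τ => min t {a | NbhdIso A a r τ.2.1 τ.2.2}.ncard
  have hN : ∀ {δ : Type u} {R : L.Structure δ} {A : (withRel L k).Structure δ}, K δ R →
      DegreeBounded R d → Presents P A R → ∀ a, (nbhd A a r).encard ≤ N :=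
    fun hR hRd hA a => (hRd.of_nbhd_subset (hν _ _ hR _ hA)).encard_nbhd_le a r
  -- Vectors from both structures are pooled, so that a maximal one cannot be exceeded on either
  -- side.
  let W : Set (PointedStructure.{u} (withRel L k) N → ℕ) :=
    {v | (∃ A, Presents P A S ∧ count A = v) ∨ ∃ B, Presents P B S' ∧ count B = v}
  have hWfin : W.Finite := (Set.finite_Iic fun _ => t).subset <| by
    rintro v (⟨A, -, rfl⟩ | ⟨A, -, rfl⟩)
    · exact fun τ => min_le_left _ _
    · exact fun τ => min_le_left _ _
  obtain ⟨A₀, hA₀⟩ := hP.2 α S hS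
  obtain ⟨v, hv, hmax⟩ := hWfin.exists_maximal ⟨_, Or.inl ⟨A₀, hA₀, rfl⟩⟩
  rcases hv with ⟨A, hA, rfl⟩ | ⟨B, hB, rfl⟩
  · obtain ⟨B, hB, hAB⟩ := exists_presents_ncard_le hsub hP helem hloc hν
      (fun τ : PointedStructure.{u} (withRel L k) N => τ.2.1) (fun τ => τ.2.2) hS hS'
      (hiso α β S S' inferInstance hd' h) hA
    have hle : count B ≤ count A := hmax (Or.inr ⟨B, hB, rfl⟩) hAB
    exact ⟨A, B, hA, hB, hanfEquiv_of_pointedStructure (hN hS hd hA) (hN hS' hd' hB)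
      fun τ => le_antisymm (hAB τ) (hle τ)⟩
  · obtain ⟨A, hA, hBA⟩ := exists_presents_ncard_le hsub hP helem hloc hν
      (fun τ : PointedStructure.{u} (withRel L k) N => τ.2.1) (fun τ => τ.2.2) hS' hS
      (hiso β α S' S inferInstance hd h.symm) hB
    have hle : count A ≤ count B := hmax (Or.inl ⟨A, hA, rfl⟩) hBA
    exact ⟨A, B, hA, hB, hanfEquiv_of_pointedStructure (hN hS hd hA) (hN hS' hd' hB)
      fun τ => le_antisymm (hle τ) (hBA τ)⟩

end Schemes

end HanfLocality

theorem mainTheorem3 (L : FirstOrder.Language.{v, w}) [L.IsRelational]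
    [Finite L.Symbols] (k : ℕ)
    (K : HanfLocality.StructClass.{u} L)
    (hfin : ∀ (α : Type u) (S : L.Structure α), K α S → Finite α ∧ Nonempty α)
    (hsub : HanfLocality.SubstructureClosed K)
    (P : HanfLocality.StructClass.{u} (HanfLocality.withRel L k))
    (hP : HanfLocality.IsPresentationScheme P K)
    (helem : HanfLocality.IsElementaryScheme P K)
    (hnb : HanfLocality.IsNeighborhoodBounded P K)
    (hloc : HanfLocality.IsLocalScheme P K)
    (J : HanfLocality.StructClass.{u} L)
    (hJ : HanfLocality.IsInvariantElementary P K J) :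
    ∀ d : ℕ, ∃ r t : ℕ,
      HanfLocality.HanfThresholdLocal r t J
        (fun α S => K α S ∧ HanfLocality.DegreeBounded S d) := by
  obtain ⟨ν, hν⟩ := hnb
  obtain ⟨θ, hinv, hθ⟩ := hJ
  intro d
  obtain ⟨r, t, hrt⟩ := HanfLocality.exists_sat_iff_of_hanfEquiv.{u} ((d + 1) ^ ν) θ
  obtain ⟨r', t', h⟩ :=
    HanfLocality.exists_presents_hanfEquiv hfin hsub hP helem hloc hν d r t
  refine ⟨r', t', fun α β S S' hS hS' hSS' => ?_⟩
  obtain ⟨A, B, hA, hB, hAB⟩ := h α β S S' hS.1 hS'.1 hS.2 hS'.2 hSS'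
  have key := hrt α β A B (hfin α S hS.1).2 (hfin β S' hS'.1).2
    (hS.2.of_nbhd_subset (hν α S hS.1 A hA)) (hS'.2.of_nbhd_subset (hν β S' hS'.1 B hB)) hAB
  rw [hθ α S hS.1, hθ β S' hS'.1]
  -- Invariance moves truth from an arbitrary presentation to the specially chosen one.
  exact ⟨fun hJ => ⟨B, hB, key.1 ((hinv α S hS.1).1 hJ A hA)⟩,
    fun hJ => ⟨A, hA, key.2 ((hinv β S' hS'.1).1 hJ B hB)⟩⟩
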